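/- Let $n \le 3$ and let $K \subseteq \mathbb{R}^n$ be a symmetric convex body, i.e. a compact convex set with non-empty interior that has a center of symmetry (not necessarily the origin). Let $B^n$ be the closed Euclidean unit ball of $\mathbb{R}^n$ and let $$d_{BM}(K,B^n) = \inf\{\rho>0 : K+u \subseteq T(B^n+v) \subseteq \rho\,(K+u)\}$$ be the Banach–Mazur distance of $K$ and $B^n$, where the infimum is taken over all invertible linear operators $T:\mathbb{R}^n\to\mathbb{R}^n$ and all vectors $u,v\in\mathbb{R}^n$. If $d_{BM}(K,B^n)=\sqrt{n}$, then $K$ is the image under an invertible affine map $\mathbb{R}^n\to\mathbb{R}^n$ of the cube $[-1,1]^n$ or of its polar $\{y\in\mathbb{R}^n : \langle x,y\rangle\le 1 \text{ for all } x\in[-1,1]^n\}$, the cross-polytope. -/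

import Mathlib

open scoped Pointwise

/-- A set in a real vector space is symmetric if it has a center of symmetry `c`, that is, if it
contains with each point `x` its reflection `2c - x` at `c`. -/
def IsCentrallySymmetric {E : Type*} [AddCommGroup E] [Module ℝ E] (K : Set E) : Prop :=
  ∃ c : E, ∀ x ∈ K, (2 : ℝ) • c - x ∈ K

/-- The Banach-Mazur distance of two subsets of `ℝⁿ` (meant for compact convex sets with non-empty
interior): the infimum of all `ρ > 0` such that `K + u ⊆ T (L + v) ⊆ ρ (K + u)` for some invertible
linear operator `T` and some vectors `u`, `v`. -/
noncomputable def banachMazurDist {n : ℕ} (K L : Set (EuclideanSpace ℝ (Fin n))) : ℝ :=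
  sInf {ρ : ℝ | 0 < ρ ∧
    ∃ (T : EuclideanSpace ℝ (Fin n) ≃ₗ[ℝ] EuclideanSpace ℝ (Fin n))
      (u v : EuclideanSpace ℝ (Fin n)),
        u +ᵥ K ⊆ T '' (v +ᵥ L) ∧ T '' (v +ᵥ L) ⊆ ρ • (u +ᵥ K)}

/-- The unit cube `[-1, 1]ⁿ`. -/
def unitCube (n : ℕ) : Set (EuclideanSpace ℝ (Fin n)) :=
  {x | ∀ i, x i ∈ Set.Icc (-1 : ℝ) 1}

/-- The polar `{y | ⟨x, y⟩ ≤ 1 for all x ∈ X}` of a subset `X` of `ℝⁿ`. -/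
def polarSet {n : ℕ} (X : Set (EuclideanSpace ℝ (Fin n))) : Set (EuclideanSpace ℝ (Fin n)) :=
  {y | ∀ x ∈ X, inner ℝ x y ≤ 1}

/-- The unit cross-polytope, the polar of the unit cube. -/
def unitCrossPolytope (n : ℕ) : Set (EuclideanSpace ℝ (Fin n)) :=
  polarSet (unitCube n)

/-! Centre `K` and let `N` be its gauge. By compactness the distance is attained, so after a linear
change of coordinates `‖x‖ ≤ N x ≤ √n ‖x‖`, and no linear `S` makes both inequalities strict on the
sphere with `‖S x‖` in place of `‖x‖`.

Call unit vectors with `N u = √n` or `N v = 1` contact vectors. If the convex hulls of the `u ⊗ u`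
and of the `v ⊗ v` were disjoint, a separating functional would yield a perturbation of the identity
that is such an `S`. So they share a tensor `P`, of trace 1. Supporting hyperplanes give `⟪u, v⟫² ≤
1/n`, hence `‖P‖² ≤ 1/n`, which forces `P = I/n`. Thus both contact sets contain frames, and `⟪u,
v⟫² = 1/n` for all their pairs (`exists_contact_frames`).

Relative to a basis of vectors `v`, each `u` becomes a sign vector. For `n ≤ 3`, either at most `n`
antipodal pairs of signs occur and the `u` are an orthonormal basis up to signs, or `n = 3`, all
four pairs occur, and the same holds for the `v` (`IsWeightedFrame.exists_orthonormal`). The other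
frame then contains every normalized sign vector up to sign (`IsWeightedFrame.exists_eq_sign`),
which pins `N` down to a multiple of the maximum norm or to the `ℓ¹` norm. -/

theorem IsCompact.isCompact_convexHull_of_finiteDimensional {F : Type*} [NormedAddCommGroup F]
    [NormedSpace ℝ F] [FiniteDimensional ℝ F] {s : Set F} (hs : IsCompact s) :
    IsCompact (convexHull ℝ s) := by
  rcases s.eq_empty_or_nonempty with rfl | ⟨a, ha⟩
  · simp
  set d := Module.finrank ℝ F
  -- Carathéodory: `d + 1` points suffice, so the hull is a continuous image of a compact set.
  -- Shorter combinations are padded with the point `a` at weight 0.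
  have key : convexHull ℝ s = (fun p : (Fin (d + 1) → ℝ) × (Fin (d + 1) → F) =>
      ∑ i, p.1 i • p.2 i) '' (stdSimplex ℝ (Fin (d + 1)) ×ˢ Set.univ.pi fun _ => s) := by
    apply Set.Subset.antisymm
    · intro x hx
      obtain ⟨ι, hι, z, w, hz, hind, hw, hsum, hx⟩ := eq_pos_convex_span_of_mem_convexHull hx
      have hcard : Fintype.card ι ≤ Fintype.card (Fin (d + 1)) := by
        rw [Fintype.card_fin]
        exact hind.card_le_finrank_succ.trans
          (Nat.succ_le_succ (Submodule.finrank_le _))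
      obtain ⟨f⟩ := Function.Embedding.nonempty_of_card_le hcard
      classical
      refine ⟨(Function.extend f w 0, Function.extend f z (fun _ => a)), ⟨⟨?_, ?_⟩, ?_⟩, ?_⟩
      · intro i
        by_cases h : ∃ j, f j = i
        · obtain ⟨j, rfl⟩ := h
          simpa only [f.injective.extend_apply] using (hw j).le
        · simp only [Function.extend_apply' _ _ _ h]
          exact le_rfl
      · rw [← hsum]
        symm
        refine Fintype.sum_of_injective f f.injective _ _ ?_ ?_
        · intro i hi
          exact Function.extend_apply' _ _ _ hi
        · intro j
          simp only [f.injective.extend_apply]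
      · intro i _
        by_cases h : ∃ j, f j = i
        · obtain ⟨j, rfl⟩ := h
          simpa only [f.injective.extend_apply] using hz ⟨j, rfl⟩
        · simpa only [Function.extend_apply' _ _ _ h] using ha
      · rw [← hx]
        symm
        refine Fintype.sum_of_injective f f.injective _ _ ?_ ?_
        · intro i hi
          simp only [Function.extend_apply' _ _ _ hi]
          simp
        · intro j
          simp only [f.injective.extend_apply]
    · rintro _ ⟨⟨w, z⟩, ⟨hw, hz⟩, rfl⟩
      exact (convex_convexHull ℝ s).sum_mem (fun i _ => hw.1 i) hw.2
        fun i _ => subset_convexHull ℝ s (hz i trivial)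
  rw [key]
  refine ((isCompact_stdSimplex ℝ _).prod (isCompact_univ_pi fun _ => hs)).image ?_
  fun_prop

/-! ### Contact points of a norm in distance position -/

section Position

variable {n : ℕ}

/-- The rank-one tensor `x ⊗ x`. -/
noncomputable def tensorSq (x : EuclideanSpace ℝ (Fin n)) : EuclideanSpace ℝ (Fin n × Fin n) :=
  WithLp.toLp 2 fun p => x p.1 * x p.2

/-- The identity tensor. -/
noncomputable def idTensor (n : ℕ) : EuclideanSpace ℝ (Fin n × Fin n) :=
  WithLp.toLp 2 fun p => if p.1 = p.2 then 1 else 0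

theorem inner_tensorSq (x y : EuclideanSpace ℝ (Fin n)) :
    inner ℝ (tensorSq x) (tensorSq y) = inner ℝ x y ^ 2 := by
  simp only [tensorSq, PiLp.inner_apply, Fintype.sum_prod_type, sq, Finset.sum_mul_sum]
  refine Finset.sum_congr rfl fun i _ => Finset.sum_congr rfl fun j _ => ?_
  simp
  ring

theorem inner_idTensor_tensorSq (x : EuclideanSpace ℝ (Fin n)) :
    inner ℝ (idTensor n) (tensorSq x) = ‖x‖ ^ 2 := by
  rw [EuclideanSpace.real_norm_sq_eq]
  simp [tensorSq, idTensor, PiLp.inner_apply, Fintype.sum_prod_type, sq]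

theorem inner_idTensor_self : inner ℝ (idTensor n) (idTensor n) = (n : ℝ) := by
  rw [real_inner_self_eq_norm_sq, EuclideanSpace.real_norm_sq_eq, Fintype.sum_prod_type]
  simp [idTensor]

theorem continuous_tensorSq : Continuous (tensorSq (n := n)) := by
  unfold tensorSq
  fun_prop

/-- Every linear functional of `x ⊗ x` is a quadratic form `⟪A x, x⟫`. -/
theorem exists_inner_eq_apply_tensorSq (g : EuclideanSpace ℝ (Fin n × Fin n)) :
    ∃ A : EuclideanSpace ℝ (Fin n) →L[ℝ] EuclideanSpace ℝ (Fin n),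
      ∀ x, inner ℝ (A x) x = inner ℝ g (tensorSq x) := by
  refine ⟨LinearMap.toContinuousLinearMap
    (Matrix.toEuclideanLin (Matrix.of fun i j => g (i, j))), fun x => ?_⟩
  simp only [tensorSq, PiLp.inner_apply, Fintype.sum_prod_type]
  refine Finset.sum_congr rfl fun i _ => ?_
  simp [Matrix.toLpLin_apply, Matrix.mulVec, dotProduct, Finset.mul_sum]
  refine Finset.sum_congr rfl fun j _ => ?_
  ring

theorem continuous_of_le_mul_norm {N : Seminorm ℝ (EuclideanSpace ℝ (Fin n))} {r : ℝ}
    (hup : ∀ x, N x ≤ r * ‖x‖) : Continuous N := by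
  have : LipschitzWith r.toNNReal N := by
    refine LipschitzWith.of_dist_le_mul fun x y => ?_
    rw [Real.dist_eq, dist_eq_norm]
    calc |N x - N y| ≤ N (x - y) := abs_sub_map_le_sub N x y
      _ ≤ r * ‖x - y‖ := hup _
      _ ≤ _ := mul_le_mul_of_nonneg_right (Real.le_coe_toNNReal r) (norm_nonneg _)
  exact this.continuous

theorem norm_add_smul_sq (x y : EuclideanSpace ℝ (Fin n)) (t : ℝ) :
    ‖x + t • y‖ ^ 2 = ‖x‖ ^ 2 + t * (2 * inner ℝ y x + t * ‖y‖ ^ 2) := by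
  rw [norm_add_sq_real, inner_smul_right, norm_smul, mul_pow, Real.norm_eq_abs, sq_abs,
    real_inner_comm]
  ring

/-- Ader's necessary condition for the Euclidean ball to be in distance position. -/
theorem exists_mem_convexHull_contact {N : Seminorm ℝ (EuclideanSpace ℝ (Fin n))} {r : ℝ}
    (hr : 0 < r)
    (hlow : ∀ x, ‖x‖ ≤ N x) (hup : ∀ x, N x ≤ r * ‖x‖)
    (hmin : ¬ ∃ S : EuclideanSpace ℝ (Fin n) →L[ℝ] EuclideanSpace ℝ (Fin n),
      ∀ x, ‖x‖ = 1 → ‖S x‖ < N x ∧ N x < r * ‖S x‖) :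
    ∃ P : EuclideanSpace ℝ (Fin n × Fin n),
      P ∈ convexHull ℝ (tensorSq '' {u | ‖u‖ = 1 ∧ N u = r}) ∧
      P ∈ convexHull ℝ (tensorSq '' {v | ‖v‖ = 1 ∧ N v = 1}) := by
  by_contra hcon
  have hN : Continuous N := continuous_of_le_mul_norm hup
  have hsph : IsCompact {x : EuclideanSpace ℝ (Fin n) | ‖x‖ = 1} := by
    simpa [Metric.sphere, dist_zero_right] using isCompact_sphere (0 : EuclideanSpace ℝ (Fin n)) 1
  have hcomp : ∀ c : ℝ, IsCompact (convexHull ℝ (tensorSq '' {u | ‖u‖ = 1 ∧ N u = c})) := by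
    intro c
    refine IsCompact.isCompact_convexHull_of_finiteDimensional (IsCompact.image ?_
      continuous_tensorSq)
    exact hsph.inter_right (isClosed_eq hN continuous_const)
  obtain ⟨f, a, b, hf1, hab, hf2⟩ := geometric_hahn_banach_compact_closed (convex_convexHull ℝ _)
    (hcomp 1) (convex_convexHull ℝ _) (hcomp r).isClosed
    (Set.disjoint_left.2 fun P h1 h2 => hcon ⟨P, h2, h1⟩)
  -- Subtracting `a • idTensor n` subtracts the constant `a` on the unit sphere, so the form is
  -- negative at the `v` and positive at the `u`.
  obtain ⟨A, hA⟩ := exists_inner_eq_apply_tensorSq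
    ((InnerProductSpace.toDual ℝ _).symm f - a • idTensor n)
  have hA' : ∀ x, ‖x‖ = 1 → inner ℝ (A x) x = f (tensorSq x) - a := by
    intro x hx
    rw [hA, inner_sub_left, InnerProductSpace.toDual_symm_apply, inner_smul_left,
      inner_idTensor_tensorSq, hx]
    simp
  have hV : ∀ x, ‖x‖ = 1 → N x = 1 → inner ℝ (A x) x < 0 := fun x hx hNx => by
    have := hf1 _ (subset_convexHull ℝ _ ⟨x, ⟨hx, hNx⟩, rfl⟩)
    rw [hA' x hx]
    linarith
  have hU : ∀ x, ‖x‖ = 1 → N x = r → 0 < inner ℝ (A x) x := fun x hx hNx => by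
    have := hf2 _ (subset_convexHull ℝ _ ⟨x, ⟨hx, hNx⟩, rfl⟩)
    rw [hA' x hx]
    linarith
  have hc1 : Continuous fun z : ℝ × EuclideanSpace ℝ (Fin n) => ‖z.2 + z.1 • A z.2‖ := by fun_prop
  have hc2 : Continuous fun z : ℝ × EuclideanSpace ℝ (Fin n) =>
      2 * inner ℝ (A z.2) z.2 + z.1 * ‖A z.2‖ ^ 2 := by fun_prop
  have hc3 : Continuous fun z : ℝ × EuclideanSpace ℝ (Fin n) => N z.2 := hN.comp continuous_snd
  -- The improving map is `id + t A`. Away from contact, strictness at `t = 0` persists; at contact,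
  -- the sign of `⟪A x, x⟫` decides to first order. Compactness of the sphere makes `t` uniform.
  have hev := hsph.eventually_forall_of_forall_eventually (x₀ := (0 : ℝ))
    (P := fun t x => 0 < t → ‖x‖ = 1 → ‖x + t • A x‖ < N x ∧ N x < r * ‖x + t • A x‖) (by
      intro x hx
      have h1 : ∀ᶠ z : ℝ × EuclideanSpace ℝ (Fin n) in nhds (0, x),
          0 < z.1 → ‖z.2‖ = 1 → ‖z.2 + z.1 • A z.2‖ < N z.2 := by
        rcases (hlow x).eq_or_lt with h | h
        · have h0 : 2 * inner ℝ (A x) x + (0 : ℝ) * ‖A x‖ ^ 2 < 0 := by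
            have := hV x hx (h.symm.trans hx)
            linarith
          have := (hc2.tendsto (0, x)).eventually (gt_mem_nhds h0)
          filter_upwards [this] with z hz hz1 hz2
          refine lt_of_lt_of_le ?_ (hlow z.2)
          refine lt_of_pow_lt_pow_left₀ 2 (norm_nonneg _) ?_
          rw [norm_add_smul_sq]
          linarith [mul_neg_of_pos_of_neg hz1 hz]
        · have h0 : ‖x + (0 : ℝ) • A x‖ < N x := by simpa using h
          filter_upwards [(hc1.tendsto (0, x)).eventually_lt (hc3.tendsto (0, x)) h0] with z hz _ _
          exact hz
      have h2 : ∀ᶠ z : ℝ × EuclideanSpace ℝ (Fin n) in nhds (0, x),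
          0 < z.1 → ‖z.2‖ = 1 → N z.2 < r * ‖z.2 + z.1 • A z.2‖ := by
        rcases (hup x).eq_or_lt with h | h
        · have h0 : 0 < 2 * inner ℝ (A x) x + (0 : ℝ) * ‖A x‖ ^ 2 := by
            have hx' : ‖x‖ = 1 := hx
            have := hU x hx (by rw [h, hx', mul_one])
            linarith
          have := (hc2.tendsto (0, x)).eventually (lt_mem_nhds h0)
          filter_upwards [this] with z hz hz1 hz2
          refine lt_of_le_of_lt (hup z.2) (mul_lt_mul_of_pos_left ?_ hr)
          refine lt_of_pow_lt_pow_left₀ 2 (norm_nonneg _) ?_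
          rw [norm_add_smul_sq]
          linarith [mul_pos hz1 hz]
        · have h0 : N x < r * ‖x + (0 : ℝ) • A x‖ := by simpa using h
          filter_upwards [(hc3.tendsto (0, x)).eventually_lt
            ((continuous_const.mul hc1).tendsto (0, x)) h0] with z hz _ _
          exact hz
      filter_upwards [h1, h2] with z hz1 hz2 ht hz
      exact ⟨hz1 ht hz, hz2 ht hz⟩)
  obtain ⟨t, ht, ht0⟩ := ((hev.filter_mono nhdsWithin_le_nhds).and
    (self_mem_nhdsWithin (s := Set.Ioi (0 : ℝ)))).exists
  exact hmin ⟨ContinuousLinearMap.id ℝ _ + t • A, fun x hx => by simpa using ht x hx ht0 hx⟩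

/-- Supporting hyperplane at a contact point with the inscribed ball. -/
theorem mul_inner_le_of_contact {N : Seminorm ℝ (EuclideanSpace ℝ (Fin n))} {r : ℝ} (hr : 0 < r)
    (hup : ∀ x, N x ≤ r * ‖x‖) {u : EuclideanSpace ℝ (Fin n)} (hu : ‖u‖ = 1) (hNu : N u = r)
    (x : EuclideanSpace ℝ (Fin n)) : r * inner ℝ u x ≤ N x := by
  refine le_of_forall_pos_le_add fun ε hε => ?_
  -- Chosen so that the second-order error `r t ‖x‖² / 2` is at most `ε`; the `+ 1` covers `x = 0`.
  set t : ℝ := ε / (r * (‖x‖ ^ 2 + 1)) with ht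
  have hx : 0 < ‖x‖ ^ 2 + 1 := by positivity
  have ht0 : 0 < t := by positivity
  have htε : t * (r * (‖x‖ ^ 2 + 1)) = ε := div_mul_cancel₀ _ (by positivity)
  have h1 : N u ≤ N (u + (-t) • x) + t * N x := by
    calc N u = N ((u + (-t) • x) + t • x) := by congr 1; module
      _ ≤ _ := map_add_le_add N _ _
      _ = _ := by rw [map_smul_eq_mul, Real.norm_of_nonneg ht0.le]
  have h2 := norm_add_smul_sq u x (-t)
  have h3 := hup (u + (-t) • x)
  rw [hu, real_inner_comm] at h2
  have h4 : ‖u + (-t) • x‖ ≤ 1 - t * inner ℝ u x + t ^ 2 * ‖x‖ ^ 2 / 2 := by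
    nlinarith [sq_nonneg (‖u + (-t) • x‖ - 1)]
  have h5 : t * (r * inner ℝ u x) ≤ t * (N x + ε) := by
    have := mul_le_mul_of_nonneg_left h4 hr.le
    rw [← htε]
    nlinarith [mul_pos hr (mul_pos ht0 ht0), mul_nonneg (mul_pos hr (mul_pos ht0 ht0)).le
      (sq_nonneg ‖x‖)]
  exact le_of_mul_le_mul_left h5 ht0

end Position

/-! ### Decompositions of the identity -/

section Frames

variable {n : ℕ}

/-- Unit vectors with positive weights of total mass one that decompose `n⁻¹ • id`. -/
structure IsWeightedFrame {ι : Type} [Fintype ι] (w : ι → ℝ)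
    (v : ι → EuclideanSpace ℝ (Fin n)) : Prop where
  pos : ∀ i, 0 < w i
  sum_eq_one : ∑ i, w i = 1
  norm_eq_one : ∀ i, ‖v i‖ = 1
  sum_inner_sq : ∀ x, ∑ i, w i * inner ℝ (v i) x ^ 2 = ‖x‖ ^ 2 / n

theorem inner_le_of_mem_convexHull {F : Type*} [NormedAddCommGroup F] [InnerProductSpace ℝ F]
    {s : Set F} {T P : F} {c : ℝ} (h : ∀ z ∈ s, inner ℝ T z ≤ c) (hP : P ∈ convexHull ℝ s) :
    inner ℝ T P ≤ c :=
  convexHull_min (t := {z | inner ℝ T z ≤ c}) h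
    (convex_halfSpace_le (innerSL ℝ T).toLinearMap.isLinear c) hP

theorem inner_eq_of_mem_convexHull {F : Type*} [NormedAddCommGroup F] [InnerProductSpace ℝ F]
    {s : Set F} {T P : F} {c : ℝ} (h : ∀ z ∈ s, inner ℝ T z = c) (hP : P ∈ convexHull ℝ s) :
    inner ℝ T P = c :=
  convexHull_min (t := {z | inner ℝ T z = c}) h
    (convex_hyperplane (innerSL ℝ T).toLinearMap.isLinear c) hP

theorem exists_isWeightedFrame_of_mem_convexHull {s : Set (EuclideanSpace ℝ (Fin n))}
    (hs : ∀ x ∈ s, ‖x‖ = 1) (h : (n : ℝ)⁻¹ • idTensor n ∈ convexHull ℝ (tensorSq '' s)) :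
    ∃ (ι : Type) (_ : Fintype ι) (w : ι → ℝ) (v : ι → EuclideanSpace ℝ (Fin n)),
      IsWeightedFrame w v ∧ ∀ i, v i ∈ s := by
  obtain ⟨ι, hι, z, w, hz, -, hw, hsum, hP⟩ := eq_pos_convex_span_of_mem_convexHull h
  choose v hv hvz using fun i => hz ⟨i, rfl⟩
  refine ⟨ι, hι, w, v, ⟨hw, hsum, fun i => hs _ (hv i), fun x => ?_⟩, hv⟩
  have := congrArg (fun T => inner ℝ T (tensorSq x)) hP
  simp only [sum_inner, inner_smul_left, inner_idTensor_tensorSq] at this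
  simp only [← hvz, inner_tensorSq] at this
  rw [div_eq_inv_mul]
  simpa using this

theorem exists_contact_frames (hn : 0 < n) {N : Seminorm ℝ (EuclideanSpace ℝ (Fin n))}
    (hlow : ∀ x, ‖x‖ ≤ N x) (hup : ∀ x, N x ≤ √n * ‖x‖)
    (hmin : ¬ ∃ S : EuclideanSpace ℝ (Fin n) →L[ℝ] EuclideanSpace ℝ (Fin n),
      ∀ x, ‖x‖ = 1 → ‖S x‖ < N x ∧ N x < √n * ‖S x‖) :
    ∃ (ι κ : Type) (_ : Fintype ι) (_ : Fintype κ) (w : ι → ℝ) (μ : κ → ℝ)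
      (u : ι → EuclideanSpace ℝ (Fin n)) (v : κ → EuclideanSpace ℝ (Fin n)),
      IsWeightedFrame w u ∧ IsWeightedFrame μ v ∧ (∀ i x, √n * |inner ℝ (u i) x| ≤ N x) ∧
      (∀ j, N (v j) = 1) ∧ ∀ i j, inner ℝ (u i) (v j) ^ 2 = (n : ℝ)⁻¹ := by
  have hn' : (0 : ℝ) < n := Nat.cast_pos.2 hn
  have hr : 0 < √(n : ℝ) := Real.sqrt_pos.2 hn'
  obtain ⟨P, hPU, hPV⟩ := exists_mem_convexHull_contact hr hlow hup hmin
  have hsupp : ∀ u, ‖u‖ = 1 → N u = √n → ∀ x, √n * |inner ℝ u x| ≤ N x := by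
    intro u hu hNu x
    rcases abs_cases (inner ℝ u x : ℝ) with ⟨h, -⟩ | ⟨h, -⟩
    · rw [h]
      exact mul_inner_le_of_contact hr hup hu hNu x
    · rw [h, ← inner_neg_right, ← map_neg_eq_map N]
      exact mul_inner_le_of_contact hr hup hu hNu (-x)
  have hle : ∀ u v, ‖u‖ = 1 → N u = √n → N v = 1 → inner ℝ u v ^ 2 ≤ (n : ℝ)⁻¹ := by
    intro u v hu hNu hNv
    have h := hsupp u hu hNu v
    rw [hNv] at h
    have h2 : (√n * |inner ℝ u v|) ^ 2 ≤ 1 := pow_le_one₀ (by positivity) h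
    rw [mul_pow, sq_abs, Real.sq_sqrt hn'.le] at h2
    rw [← one_div, le_div_iff₀' hn']
    exact h2
  have hPP : inner ℝ P P ≤ (n : ℝ)⁻¹ := by
    refine inner_le_of_mem_convexHull ?_ hPV
    rintro _ ⟨v, ⟨hv, hNv⟩, rfl⟩
    rw [real_inner_comm]
    refine inner_le_of_mem_convexHull ?_ hPU
    rintro _ ⟨u, ⟨hu, hNu⟩, rfl⟩
    rw [inner_tensorSq, real_inner_comm]
    exact hle u v hu hNu hNv
  have htr : inner ℝ (idTensor n) P = (1 : ℝ) := by
    refine inner_eq_of_mem_convexHull ?_ hPV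
    rintro _ ⟨v, ⟨hv, -⟩, rfl⟩
    rw [inner_idTensor_tensorSq, hv, one_pow]
  -- `‖P - I/n‖² = ‖P‖² - 2/n + 1/n ≤ 0`.
  have hP : P = (n : ℝ)⁻¹ • idTensor n := by
    rw [← sub_eq_zero, ← norm_eq_zero, ← sq_eq_zero_iff]
    refine le_antisymm ?_ (sq_nonneg _)
    rw [norm_sub_sq_real, norm_smul, mul_pow, ← real_inner_self_eq_norm_sq (idTensor n),
      ← real_inner_self_eq_norm_sq P, inner_smul_right, real_inner_comm (idTensor n) P,
      htr, inner_idTensor_self,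
      Real.norm_eq_abs, sq_abs]
    have : ((n : ℝ)⁻¹) ^ 2 * n = (n : ℝ)⁻¹ := by field_simp
    rw [this]
    linarith
  rw [hP] at hPU hPV
  obtain ⟨ι, hι, w, u, hu, huU⟩ := exists_isWeightedFrame_of_mem_convexHull (fun x hx => hx.1) hPU
  obtain ⟨κ, hκ, μ, v, hv, hvV⟩ := exists_isWeightedFrame_of_mem_convexHull (fun x hx => hx.1) hPV
  refine ⟨ι, κ, hι, hκ, w, μ, u, v, hu, hv, fun i => hsupp _ (huU i).1 (huU i).2,
    fun j => (hvV j).2, fun i j => ?_⟩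
  -- By the frame identity at `u i` these nonnegative terms sum to zero, so each vanishes.
  have hnn : ∀ j, 0 ≤ μ j * ((n : ℝ)⁻¹ - inner ℝ (u i) (v j) ^ 2) := fun j =>
    mul_nonneg (hv.pos j).le (sub_nonneg.2 (hle _ _ (huU i).1 (huU i).2 (hvV j).2))
  have hs : ∑ j, μ j * ((n : ℝ)⁻¹ - inner ℝ (u i) (v j) ^ 2) = 0 := by
    have h := hv.sum_inner_sq (u i)
    simp only [real_inner_comm (u i)] at h
    simp only [mul_sub, Finset.sum_sub_distrib, ← Finset.sum_mul, hv.sum_eq_one, h,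
      hu.norm_eq_one]
    simp
  have := (Finset.sum_eq_zero_iff_of_nonneg fun j _ => hnn j).1 hs j (Finset.mem_univ j)
  rcases mul_eq_zero.1 this with h | h
  · exact absurd h (hv.pos j).ne'
  · linarith

namespace IsWeightedFrame

variable {ι : Type} [Fintype ι] {w : ι → ℝ} {v : ι → EuclideanSpace ℝ (Fin n)}

/-- Let `m l` be the total weight on `±b l`. The frame identity says that the matrix with columns `b
l`, times the one with rows `n m l b l`, is the identity. Both are square, so the product in the
other order is too: `n m l ⟪b l, b l'⟫ = δ`. -/
theorem orthonormal (h : IsWeightedFrame w v) (hn : 0 < n) {b : Fin n → EuclideanSpace ℝ (Fin n)}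
    (hb : ∀ j, ∃ k, v j = b k ∨ v j = -b k) : Orthonormal ℝ b := by
  classical
  have hn' : (0 : ℝ) < n := Nat.cast_pos.2 hn
  choose k hk using hb
  set m : Fin n → ℝ := fun l => ∑ j with k j = l, w j with hm
  have hquad : ∀ x, ∑ l, m l * inner ℝ (b l) x ^ 2 = ‖x‖ ^ 2 / n := by
    intro x
    rw [← h.sum_inner_sq x, ← Finset.sum_fiberwise Finset.univ k]
    refine Finset.sum_congr rfl fun l _ => ?_
    rw [hm, Finset.sum_mul]
    refine Finset.sum_congr rfl fun j hj => ?_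
    rw [← (Finset.mem_filter.1 hj).2]
    rcases hk j with h | h <;> simp [h]
  have hpol : ∀ x y, ∑ l, m l * (inner ℝ (b l) x * inner ℝ (b l) y) = inner ℝ x y / n := by
    intro x y
    have h1 := hquad (x + y)
    have h2 := hquad (x - y)
    rw [norm_add_sq_real] at h1
    rw [norm_sub_sq_real] at h2
    have h3 : ∑ l, m l * (inner ℝ (b l) x * inner ℝ (b l) y) =
        (∑ l, m l * inner ℝ (b l) (x + y) ^ 2 - ∑ l, m l * inner ℝ (b l) (x - y) ^ 2) / 4 := by
      rw [← Finset.sum_sub_distrib, Finset.sum_div]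
      refine Finset.sum_congr rfl fun l _ => ?_
      rw [inner_add_right, inner_sub_right]
      ring
    rw [h3, h1, h2]
    ring
  have hmat : (Matrix.of fun i l => b l i) * (Matrix.of fun l i => n * m l * b l i) =
      (1 : Matrix (Fin n) (Fin n) ℝ) := by
    ext i j
    have := hpol (EuclideanSpace.single i 1) (EuclideanSpace.single j 1)
    simp only [EuclideanSpace.inner_single_right] at this
    rw [Matrix.mul_apply, Matrix.one_apply]
    have h4 : ∑ l, b l i * (n * m l * b l j) = n * ∑ l, m l * (b l i * b l j) := by
      rw [Finset.mul_sum]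
      exact Finset.sum_congr rfl fun l _ => by ring
    simp only [Matrix.of_apply]
    rw [h4]
    simp only [one_mul, conj_trivial] at this
    rw [this, mul_div_cancel₀ _ hn'.ne']
    simp [PiLp.single_apply, eq_comm]
  rw [mul_eq_one_comm] at hmat
  have hin : ∀ l l', n * m l * inner ℝ (b l) (b l') = if l = l' then (1 : ℝ) else 0 := by
    intro l l'
    have := congrFun (congrFun hmat l) l'
    rw [Matrix.mul_apply, Matrix.one_apply] at this
    rw [← this, PiLp.inner_apply, Finset.mul_sum]
    refine Finset.sum_congr rfl fun i _ => ?_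
    simp
    ring
  have hml : ∀ l, m l ≠ 0 := fun l h0 => by simpa [h0] using hin l l
  refine ⟨fun l => ?_, fun l l' hll => ?_⟩
  · obtain ⟨j, hj, -⟩ := Finset.exists_ne_zero_of_sum_ne_zero (hml l)
    have hj := (Finset.mem_filter.1 hj).2
    rw [← h.norm_eq_one j, ← hj]
    rcases hk j with h | h <;> simp [h]
  · have := hin l l'
    rw [if_neg hll] at this
    exact (mul_eq_zero.1 this).resolve_left (mul_ne_zero hn'.ne' (hml l))

/-- A missed `e k` would be orthogonal to the whole frame, contradicting the frame identity at `e
k`. -/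
theorem exists_eq_or_eq_neg (h : IsWeightedFrame w v) (hn : 0 < n)
    {e : Fin n → EuclideanSpace ℝ (Fin n)} (he : Orthonormal ℝ e)
    (hv : ∀ j, ∃ k, v j = e k ∨ v j = -e k) (k : Fin n) : ∃ j, v j = e k ∨ v j = -e k := by
  by_contra! hcon
  have h1 := h.sum_inner_sq (e k)
  rw [Finset.sum_eq_zero, he.1 k] at h1
  · have : (0 : ℝ) < n := Nat.cast_pos.2 hn
    simp [this.ne] at h1
  · intro j _
    obtain ⟨l, hl⟩ := hv j
    have hlk : l ≠ k := by
      rintro rfl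
      exact hl.elim (hcon j).1 (hcon j).2
    have := he.2 hlk
    rcases hl with hl | hl <;> simp [hl, this]

theorem exists_basis (h : IsWeightedFrame w v) (hn : 0 < n) :
    ∃ β : Module.Basis (Fin n) ℝ (EuclideanSpace ℝ (Fin n)), ∀ k, β k ∈ Set.range v := by
  have hspan : Submodule.span ℝ (Set.range v) = ⊤ := by
    rw [← Submodule.orthogonal_eq_bot_iff, Submodule.eq_bot_iff]
    intro x hx
    have h1 := h.sum_inner_sq x
    rw [Finset.sum_eq_zero] at h1
    · have : (n : ℝ) ≠ 0 := Nat.cast_ne_zero.2 hn.ne'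
      have h2 := (div_eq_zero_iff.1 h1.symm).resolve_right this
      simpa using h2
    · intro j _
      rw [(Submodule.mem_orthogonal _ _).1 hx _ (Submodule.subset_span ⟨j, rfl⟩)]
      simp
  obtain ⟨b, hb, hbs, hbl⟩ := exists_linearIndependent ℝ (Set.range v)
  let β := Module.Basis.mk hbl (by rw [Subtype.range_coe, hbs, hspan])
  have : Fintype b := FiniteDimensional.fintypeBasisIndex β
  have hcard : Fintype.card b = n := by
    rw [← Module.finrank_eq_card_basis β, finrank_euclideanSpace_fin]
  refine ⟨β.reindex (Fintype.equivFinOfCardEq hcard), fun k => ?_⟩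
  rw [Module.Basis.reindex_apply, Module.Basis.mk_apply]
  exact hb (Subtype.coe_prop _)

end IsWeightedFrame

end Frames

/-! ### Sign vectors in dimension at most three -/

section Signs

variable {n : ℕ}

/-- Sign vectors that are neither equal nor opposite have inner product 0 for `n = 2` and `±1` for
`n = 3`. For `n = 4` the value 2 occurs. -/
theorem eq_or_eq_neg_or_sq_sum_le_one (hn : n ≤ 3) {s t : Fin n → ℝ} (hs : ∀ k, s k = 1 ∨ s k = -1)
    (ht : ∀ k, t k = 1 ∨ t k = -1) :
    t = s ∨ t = -s ∨ (2 ≤ n ∧ (∑ k, t k * s k) ^ 2 ≤ 1) := by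
  interval_cases n
  · exact Or.inl (Subsingleton.elim _ _)
  · simp only [Fin.forall_fin_one, funext_iff, Pi.neg_apply] at *
    rcases hs with h | h <;> rcases ht with h' | h' <;> norm_num [h, h']
  · simp only [Fin.forall_fin_two, funext_iff, Pi.neg_apply, Fin.sum_univ_two] at *
    obtain ⟨h0 | h0, h1 | h1⟩ := hs <;> obtain ⟨h0' | h0', h1' | h1'⟩ := ht <;>
      norm_num [h0, h1, h0', h1']
  · simp only [Fin.forall_fin_succ, Fin.forall_fin_zero, funext_iff, Pi.neg_apply,
      Fin.sum_univ_three, Fin.succ_zero_eq_one, Fin.succ_one_eq_two, and_true] at *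
    obtain ⟨h0 | h0, h1 | h1, h2 | h2⟩ := hs <;> obtain ⟨h0' | h0', h1' | h1', h2' | h2'⟩ := ht <;>
      norm_num [h0, h1, h2, h0', h1', h2']

/-- The eight sign vectors form four antipodal pairs; the three other than `±s` are represented by
the single flips of `s`. -/
theorem exists_eq_flip_or_eq_neg_flip {s t : Fin 3 → ℝ} (hs : ∀ k, s k = 1 ∨ s k = -1)
    (ht : ∀ k, t k = 1 ∨ t k = -1) (h1 : t ≠ s) (h2 : t ≠ -s) :
    ∃ l, t = Function.update s l (-s l) ∨ t = -Function.update s l (-s l) := by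
  have hd : ∀ k, t k = s k ∨ t k = -s k := fun k => by
    rcases hs k with h | h <;> rcases ht k with h' | h' <;> simp [h, h']
  have hext : ∀ r : Fin 3 → ℝ, t 0 = r 0 → t 1 = r 1 → t 2 = r 2 → t = r := fun r h0 h1 h2 => by
    ext k
    fin_cases k <;> assumption
  rcases hd 0 with h | h <;> rcases hd 1 with h' | h' <;> rcases hd 2 with h'' | h''
  · exact absurd (hext _ h h' h'') h1
  · exact ⟨2, Or.inl (hext _ (by simp [h]) (by simp [h']) (by simp [h'']))⟩
  · exact ⟨1, Or.inl (hext _ (by simp [h]) (by simp [h']) (by simp [h'']))⟩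
  · exact ⟨0, Or.inr (hext _ (by simp [h]) (by simp [h']) (by simp [h'']))⟩
  · exact ⟨0, Or.inl (hext _ (by simp [h]) (by simp [h']) (by simp [h'']))⟩
  · exact ⟨1, Or.inr (hext _ (by simp [h]) (by simp [h']) (by simp [h'']))⟩
  · exact ⟨2, Or.inr (hext _ (by simp [h]) (by simp [h']) (by simp [h'']))⟩
  · exact absurd (hext _ h h' h'') h2

theorem eq_or_eq_neg_fin_two {t : Fin 2 → ℝ} (ht : ∀ k, t k = 1 ∨ t k = -1) :
    ∃ l : Fin 2, t = ![![1, 1], ![1, -1]] l ∨ t = -![![1, 1], ![1, -1]] l := by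
  simp only [Fin.forall_fin_two, funext_iff, Fin.exists_fin_two] at *
  obtain ⟨h0 | h0, h1 | h1⟩ := ht <;> norm_num [h0, h1]

/-- The four sums tested are `±1`, and the first is the sum of the other three. This leaves six sign
choices, one for each signed unit vector. -/
theorem exists_eq_single_of_sq_sum_eq_one {a : Fin 3 → ℝ}
    (h : ∀ s : Fin 3 → ℝ, (∀ k, s k = 1 ∨ s k = -1) → (∑ k, a k * s k) ^ 2 = 1) :
    ∃ l, a = Pi.single l 1 ∨ a = -Pi.single l 1 := by
  have h1 := h ![1, 1, 1] (by simp [Fin.forall_fin_succ])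
  have h2 := h ![1, 1, -1] (by simp [Fin.forall_fin_succ])
  have h3 := h ![1, -1, 1] (by simp [Fin.forall_fin_succ])
  have h4 := h ![-1, 1, 1] (by simp [Fin.forall_fin_succ])
  simp only [sq_eq_one_iff, Fin.sum_univ_three, Matrix.cons_val_zero,
    Matrix.cons_val_one, Matrix.cons_val, mul_one, mul_neg] at h1 h2 h3 h4
  have hext : ∀ r : Fin 3 → ℝ, a 0 = r 0 → a 1 = r 1 → a 2 = r 2 → a = r := fun r h0 h1 h2 => by
    ext k
    fin_cases k <;> assumption
  have hcases : (a 0 = 0 ∧ a 1 = 0 ∧ (a 2 = 1 ∨ a 2 = -1)) ∨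
      (a 0 = 0 ∧ a 2 = 0 ∧ (a 1 = 1 ∨ a 1 = -1)) ∨
      (a 1 = 0 ∧ a 2 = 0 ∧ (a 0 = 1 ∨ a 0 = -1)) := by
    rcases h1 with h1 | h1 <;> rcases h2 with h2 | h2 <;> rcases h3 with h3 | h3 <;>
      rcases h4 with h4 | h4 <;>
    first
    | (exfalso; linarith)
    | exact Or.inl ⟨by linarith, by linarith, Or.inl (by linarith)⟩
    | exact Or.inl ⟨by linarith, by linarith, Or.inr (by linarith)⟩
    | exact Or.inr (Or.inl ⟨by linarith, by linarith, Or.inl (by linarith)⟩)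
    | exact Or.inr (Or.inl ⟨by linarith, by linarith, Or.inr (by linarith)⟩)
    | exact Or.inr (Or.inr ⟨by linarith, by linarith, Or.inl (by linarith)⟩)
    | exact Or.inr (Or.inr ⟨by linarith, by linarith, Or.inr (by linarith)⟩)
  rcases hcases with ⟨h, h', h'' | h''⟩ | ⟨h, h', h'' | h''⟩ | ⟨h, h', h'' | h''⟩
  · exact ⟨2, Or.inl (hext _ (by simp [h]) (by simp [h']) (by simp [h'']))⟩
  · exact ⟨2, Or.inr (hext _ (by simp [h]) (by simp [h']) (by simp [h'']))⟩
  · exact ⟨1, Or.inl (hext _ (by simp [h]) (by simp [h'']) (by simp [h']))⟩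
  · exact ⟨1, Or.inr (hext _ (by simp [h]) (by simp [h'']) (by simp [h']))⟩
  · exact ⟨0, Or.inl (hext _ (by simp [h'']) (by simp [h]) (by simp [h']))⟩
  · exact ⟨0, Or.inr (hext _ (by simp [h'']) (by simp [h]) (by simp [h']))⟩

end Signs

/-! ### One of the two frames is an orthonormal basis -/

section Dichotomy

variable {n : ℕ} {ι κ : Type} [Fintype ι] [Fintype κ] {w : ι → ℝ} {μ : κ → ℝ}
  {u : ι → EuclideanSpace ℝ (Fin n)} {v : κ → EuclideanSpace ℝ (Fin n)}

theorem sqrt_mul_eq_one_or_eq_neg_one (hn : 0 < n) {x : ℝ} (hx : x ^ 2 = (n : ℝ)⁻¹) :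
    √n * x = 1 ∨ √n * x = -1 := by
  have hn' : (0 : ℝ) < n := Nat.cast_pos.2 hn
  rw [← sq_eq_one_iff, mul_pow, Real.sq_sqrt hn'.le, hx, mul_inv_cancel₀ hn'.ne']

theorem Module.Basis.exists_inner_eq {ι' F : Type*} [NormedAddCommGroup F] [InnerProductSpace ℝ F]
    [FiniteDimensional ℝ F] (β : Module.Basis ι' ℝ F) (c : ι' → ℝ) :
    ∃ x : F, ∀ k, inner ℝ x (β k) = c k := by
  refine ⟨(InnerProductSpace.toDual ℝ F).symm (LinearMap.toContinuousLinearMap (β.constr ℝ c)),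
    fun k => ?_⟩
  rw [InnerProductSpace.toDual_symm_apply]
  simp

/-- A vector is determined by its inner products with a basis, so `n` patterns up to sign allow only
`n` vectors up to sign. -/
theorem IsWeightedFrame.exists_orthonormal_of_patterns (hu : IsWeightedFrame w u) (hn : 0 < n)
    (β : Module.Basis (Fin n) ℝ (EuclideanSpace ℝ (Fin n))) (p : Fin n → Fin n → ℝ)
    (hp : ∀ i, ∃ l, (fun k => √n * inner ℝ (u i) (β k)) = p l ∨
      (fun k => √n * inner ℝ (u i) (β k)) = -p l) :
    ∃ e : Fin n → EuclideanSpace ℝ (Fin n), Orthonormal ℝ e ∧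
      ∀ i, ∃ k, u i = e k ∨ u i = -e k := by
  have hr : √(n : ℝ) ≠ 0 := (Real.sqrt_pos.2 (Nat.cast_pos.2 hn)).ne'
  choose e he using fun l => β.exists_inner_eq fun k => (√n)⁻¹ * p l k
  have hmem : ∀ i, ∃ k, u i = e k ∨ u i = -e k := by
    intro i
    obtain ⟨l, h | h⟩ := hp i
    · refine ⟨l, Or.inl (InnerProductSpace.ext_inner_right_basis β fun k => ?_)⟩
      rw [he, ← congrFun h k, inv_mul_cancel_left₀ hr]
    · refine ⟨l, Or.inr (InnerProductSpace.ext_inner_right_basis β fun k => ?_)⟩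
      have := congrFun h k
      rw [Pi.neg_apply, eq_neg_iff_add_eq_zero] at this
      rw [inner_neg_left, he, eq_neg_iff_add_eq_zero, ← mul_eq_zero_iff_left hr, mul_add,
        mul_inv_cancel_left₀ hr, this]
  exact ⟨e, hu.orthonormal hn hmem, hmem⟩

/-- In dimension at most three, one of two dual frames is an orthonormal basis up to signs. -/
theorem IsWeightedFrame.exists_orthonormal (hn : 0 < n) (hn3 : n ≤ 3) (hu : IsWeightedFrame w u)
    (hv : IsWeightedFrame μ v) (huv : ∀ i j, inner ℝ (u i) (v j) ^ 2 = (n : ℝ)⁻¹) :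
    ∃ e : Fin n → EuclideanSpace ℝ (Fin n), Orthonormal ℝ e ∧
      ((∀ i, ∃ k, u i = e k ∨ u i = -e k) ∨ ∀ j, ∃ k, v j = e k ∨ v j = -e k) := by
  obtain ⟨β, hβ⟩ := hv.exists_basis hn
  have hsign : ∀ i k, √n * inner ℝ (u i) (β k) = 1 ∨ √n * inner ℝ (u i) (β k) = -1 := by
    intro i k
    obtain ⟨j, hj⟩ := hβ k
    rw [← hj]
    exact sqrt_mul_eq_one_or_eq_neg_one hn (huv i j)
  have hfirst : (∃ p : Fin n → Fin n → ℝ, ∀ t : Fin n → ℝ, (∀ k, t k = 1 ∨ t k = -1) →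
      (∃ i, t = fun k => √n * inner ℝ (u i) (β k)) → ∃ l, t = p l ∨ t = -p l) →
      ∃ e : Fin n → EuclideanSpace ℝ (Fin n), Orthonormal ℝ e ∧
      ((∀ i, ∃ k, u i = e k ∨ u i = -e k) ∨ ∀ j, ∃ k, v j = e k ∨ v j = -e k) := by
    rintro ⟨p, hp⟩
    obtain ⟨e, he, hue⟩ := hu.exists_orthonormal_of_patterns hn β p
      fun i => hp _ (hsign i) ⟨i, rfl⟩
    exact ⟨e, he, Or.inl hue⟩
  interval_cases n
  · refine hfirst ⟨fun _ _ => 1, fun t ht _ => ⟨0, ?_⟩⟩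
    refine (ht 0).imp (fun h => ?_) fun h => ?_ <;> ext k <;> rw [Subsingleton.elim k 0, h]
    rfl
  · exact hfirst ⟨_, fun t ht _ => eq_or_eq_neg_fin_two ht⟩
  · by_cases hall : ∀ s : Fin 3 → ℝ, (∀ k, s k = 1 ∨ s k = -1) →
        ∃ i, (fun k => √(3 : ℕ) * inner ℝ (u i) (β k)) = s ∨
          (fun k => √(3 : ℕ) * inner ℝ (u i) (β k)) = -s
    · have hmem : ∀ j, ∃ k, v j = β k ∨ v j = -β k := by
        intro j
        -- Expanding `v j` in `β` turns `⟪u i, v j⟫² = 1/3` into a condition on its coordinates for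
        -- every sign vector.
        obtain ⟨l, hl⟩ := exists_eq_single_of_sq_sum_eq_one (a := β.repr (v j)) (by
          intro s hs
          obtain ⟨i, hi⟩ := hall s hs
          have h1 : (√(3 : ℕ) * inner ℝ (u i) (v j)) ^ 2 = 1 := by
            rw [mul_pow, huv, Real.sq_sqrt (Nat.cast_nonneg _)]
            norm_num
          rw [← h1]
          conv_rhs => rw [← β.sum_repr (v j)]
          rw [inner_sum, Finset.mul_sum]
          have h2 : ∀ c : Fin 3 → ℝ, (fun k => √(3 : ℕ) * inner ℝ (u i) (β k)) = c → ∀ k,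
              √(3 : ℕ) * inner ℝ (u i) (β.repr (v j) k • β k) = β.repr (v j) k * c k := by
            rintro _ rfl k
            rw [inner_smul_right]
            ring
          rcases hi with hi | hi <;> rw [Finset.sum_congr rfl fun k _ => h2 _ hi k]
          simp)
        refine ⟨l, hl.imp (fun h => ?_) fun h => ?_⟩
        · rw [← β.sum_repr (v j), h]
          simp [Pi.single_apply]
        · rw [← β.sum_repr (v j), h]
          simp [Pi.single_apply]
      exact ⟨β, hv.orthonormal hn hmem, Or.inr hmem⟩
    · push Not at hall
      obtain ⟨s, hs, hmiss⟩ := hall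
      refine hfirst ⟨fun l => Function.update s l (-s l), ?_⟩
      rintro t ht ⟨i, rfl⟩
      exact exists_eq_flip_or_eq_neg_flip hs ht (hmiss i).1 (hmiss i).2

/-- In dimension at most three, a frame of normalized sign vectors contains all sign vectors. -/
theorem IsWeightedFrame.exists_eq_sign (hn : 0 < n) (hn3 : n ≤ 3) (hv : IsWeightedFrame μ v)
    (e : OrthonormalBasis (Fin n) ℝ (EuclideanSpace ℝ (Fin n)))
    (hve : ∀ j k, inner ℝ (v j) (e k) ^ 2 = (n : ℝ)⁻¹) {s : Fin n → ℝ}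
    (hs : ∀ k, s k = 1 ∨ s k = -1) :
    ∃ j, (fun k => √n * inner ℝ (v j) (e k)) = s ∨ (fun k => √n * inner ℝ (v j) (e k)) = -s := by
  have hn' : (0 : ℝ) < n := Nat.cast_pos.2 hn
  by_contra! hcon
  have hsum : ∀ j, 2 ≤ n ∧ (∑ k, √n * inner ℝ (v j) (e k) * s k) ^ 2 ≤ 1 := fun j =>
    ((eq_or_eq_neg_or_sq_sum_le_one hn3 hs fun k =>
      sqrt_mul_eq_one_or_eq_neg_one hn (hve j k)).resolve_left (hcon j).1).resolve_left (hcon j).2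
  -- At this vector, of squared norm `n`, the weighted mean of the squared sums in `hsum` is `n`. If
  -- `±s` is missed, each is at most 1 while `n ≥ 2`.
  have h1 := hv.sum_inner_sq (∑ k, s k • e k)
  have hnorm : ‖∑ k, s k • e k‖ ^ 2 = n := by
    rw [← e.sum_sq_norm_inner_right]
    have : ∀ k, ‖inner ℝ (e k) (∑ k, s k • e k)‖ ^ 2 = 1 := fun k => by
      rw [e.orthonormal.inner_right_fintype]
      rcases hs k with h | h <;> simp [h]
    rw [Finset.sum_congr rfl fun k _ => this k]
    simp
  rw [hnorm, div_self hn'.ne'] at h1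
  have h2 : (n : ℝ) ≤ 1 := by
    calc (n : ℝ) = ∑ j, μ j * (n * inner ℝ (v j) (∑ k, s k • e k) ^ 2) := by
          conv_lhs => rw [← mul_one (n : ℝ), ← h1, Finset.mul_sum]
          exact Finset.sum_congr rfl fun j _ => by ring
      _ ≤ ∑ j, μ j * 1 := by
          refine Finset.sum_le_sum fun j _ => mul_le_mul_of_nonneg_left ?_ (hv.pos j).le
          refine le_of_eq_of_le ?_ (hsum j).2
          rw [← Real.sq_sqrt hn'.le, ← mul_pow, inner_sum, Finset.mul_sum, Real.sq_sqrt hn'.le]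
          congr 1
          refine Finset.sum_congr rfl fun k _ => ?_
          rw [inner_smul_right]
          ring
      _ = 1 := by simp [hv.sum_eq_one]
  have hne : Nonempty κ := by
    by_contra h
    rw [not_nonempty_iff] at h
    simpa using hv.sum_eq_one
  have h3 : (2 : ℝ) ≤ n := by exact_mod_cast (hsum hne.some).1
  linarith

end Dichotomy

/-! ### Identification of the norm -/

section Norms

variable {n : ℕ} {ι κ : Type} [Fintype ι] [Fintype κ] {w : ι → ℝ} {μ : κ → ℝ}
  {u : ι → EuclideanSpace ℝ (Fin n)} {v : κ → EuclideanSpace ℝ (Fin n)}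
  {N : Seminorm ℝ (EuclideanSpace ℝ (Fin n))}

/-- The upper bound is the triangle inequality with `N (e k) = 1`. For the lower bound, some `u i`
has, up to a global sign, the signs of the coordinates of `x`. -/
theorem Seminorm.eq_sum_abs_of_frames (hn : 0 < n) (hn3 : n ≤ 3) (hu : IsWeightedFrame w u)
    (hv : IsWeightedFrame μ v) (huv : ∀ i j, inner ℝ (u i) (v j) ^ 2 = (n : ℝ)⁻¹)
    (hsupp : ∀ i x, √n * |inner ℝ (u i) x| ≤ N x) (hNv : ∀ j, N (v j) = 1)
    (e : OrthonormalBasis (Fin n) ℝ (EuclideanSpace ℝ (Fin n)))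
    (hve : ∀ j, ∃ k, v j = e k ∨ v j = -e k) (x : EuclideanSpace ℝ (Fin n)) :
    N x = ∑ k, |inner ℝ (e k) x| := by
  have hev := hv.exists_eq_or_eq_neg hn e.orthonormal hve
  have hue : ∀ i k, inner ℝ (u i) (e k) ^ 2 = (n : ℝ)⁻¹ := by
    intro i k
    obtain ⟨j, hj⟩ := hev k
    rw [← huv i j]
    rcases hj with hj | hj <;> simp [hj]
  have hNe : ∀ k, N (e k) = 1 := by
    intro k
    obtain ⟨j, hj⟩ := hev k
    rw [← hNv j]
    rcases hj with hj | hj <;> simp [hj]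
  apply le_antisymm
  · calc N x = N (∑ k, inner ℝ (e k) x • e k) := by rw [e.sum_repr']
      _ ≤ ∑ k, N (inner ℝ (e k) x • e k) :=
          Finset.le_sum_of_subadditive N (map_zero N).le (map_add_le_add N) _ _
      _ = _ := by simp [map_smul_eq_mul, hNe]
  · set s : Fin n → ℝ := fun k => if 0 ≤ inner ℝ (e k) x then 1 else -1 with hs
    have hsx : ∀ k, s k * inner ℝ (e k) x = |inner ℝ (e k) x| := fun k => by
      simp only [hs]
      split_ifs with h
      · rw [abs_of_nonneg h, one_mul]
      · rw [abs_of_neg (not_le.1 h), neg_one_mul]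
    obtain ⟨i, hi⟩ := hu.exists_eq_sign hn hn3 e hue (s := s)
      fun k => by simp only [hs]; split_ifs <;> simp
    have hsum : √n * inner ℝ (u i) x = ∑ k, √n * inner ℝ (u i) (e k) * inner ℝ (e k) x := by
      simp only [mul_assoc]
      rw [← Finset.mul_sum, e.sum_inner_mul_inner]
    have habs : |√n * inner ℝ (u i) x| = ∑ k, |inner ℝ (e k) x| := by
      rw [hsum]
      rcases hi with hi | hi
      · rw [Finset.sum_congr rfl fun k _ => by rw [congrFun hi k, hsx k],
          abs_of_nonneg (Finset.sum_nonneg fun k _ => abs_nonneg _)]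
      · rw [Finset.sum_congr rfl fun k _ => by rw [congrFun hi k, Pi.neg_apply, neg_mul, hsx k],
          Finset.sum_neg_distrib, abs_neg,
          abs_of_nonneg (Finset.sum_nonneg fun k _ => abs_nonneg _)]
    rw [← habs, abs_mul, abs_of_nonneg (Real.sqrt_nonneg _)]
    exact hsupp i x

theorem mem_convexHull_signs {y : Fin n → ℝ} (hy : ∀ k, |y k| ≤ 1) :
    y ∈ convexHull ℝ {s : Fin n → ℝ | ∀ k, s k = 1 ∨ s k = -1} := by
  have : {s : Fin n → ℝ | ∀ k, s k = 1 ∨ s k = -1} = Set.univ.pi fun _ => {1, -1} := by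
    ext s
    simp
  rw [this, convexHull_pi]
  intro k _
  rw [convexHull_pair, segment_symm, segment_eq_Icc (by norm_num)]
  exact abs_le.1 (hy k)

/-- The vectors `±e k` among the `u` bound `N` from below. Conversely, `N` is 1 at the normalized
sign vectors, which up to sign are among the `v`, and the cube is the hull of its vertices. -/
theorem Seminorm.le_one_iff_of_frames (hn : 0 < n) (hn3 : n ≤ 3) (hu : IsWeightedFrame w u)
    (hv : IsWeightedFrame μ v) (huv : ∀ i j, inner ℝ (u i) (v j) ^ 2 = (n : ℝ)⁻¹)
    (hsupp : ∀ i x, √n * |inner ℝ (u i) x| ≤ N x) (hNv : ∀ j, N (v j) = 1)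
    (e : OrthonormalBasis (Fin n) ℝ (EuclideanSpace ℝ (Fin n)))
    (hue : ∀ i, ∃ k, u i = e k ∨ u i = -e k) (x : EuclideanSpace ℝ (Fin n)) :
    N x ≤ 1 ↔ ∀ k, |√n * inner ℝ (e k) x| ≤ 1 := by
  have hr : 0 < √(n : ℝ) := Real.sqrt_pos.2 (Nat.cast_pos.2 hn)
  have heu := hu.exists_eq_or_eq_neg hn e.orthonormal hue
  have hve : ∀ j k, inner ℝ (v j) (e k) ^ 2 = (n : ℝ)⁻¹ := by
    intro j k
    obtain ⟨i, hi⟩ := heu k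
    rw [← huv i j, real_inner_comm]
    rcases hi with hi | hi <;> simp [hi]
  constructor
  · intro h k
    obtain ⟨i, hi⟩ := heu k
    refine le_trans ?_ h
    refine le_trans (le_of_eq ?_) (hsupp i x)
    rw [abs_mul, abs_of_pos hr]
    rcases hi with hi | hi <;> simp [hi]
  · intro h
    have hsub : {s : Fin n → ℝ | ∀ k, s k = 1 ∨ s k = -1} ⊆
        {y | y ∈ Set.univ ∧ (N.comp (Fintype.linearCombination ℝ e)) y ≤ √n} := by
      intro s hs
      refine ⟨trivial, ?_⟩
      obtain ⟨j, hj⟩ := hv.exists_eq_sign hn hn3 e hve hs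
      have hvs : ∀ c : Fin n → ℝ, (fun k => √n * inner ℝ (v j) (e k)) = c →
          ∑ k, c k • e k = √n • v j := by
        rintro _ rfl
        conv_rhs => rw [← e.sum_repr' (v j), Finset.smul_sum]
        refine Finset.sum_congr rfl fun k _ => ?_
        rw [smul_smul, real_inner_comm]
      have hN : N (√n • v j) = √n := by
        rw [map_smul_eq_mul, hNv, mul_one, Real.norm_of_nonneg hr.le]
      rw [Seminorm.comp_apply, Fintype.linearCombination_apply]
      rcases hj with hj | hj
      · rw [hvs _ hj, hN]
      · have := hvs _ hj
        simp only [Pi.neg_apply, neg_smul, Finset.sum_neg_distrib] at this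
        rw [← map_neg_eq_map N, this, hN]
    have hmem := convexHull_min hsub ((N.comp (Fintype.linearCombination ℝ e)).convexOn.convex_le _)
      (mem_convexHull_signs h)
    have h2 := hmem.2
    rw [Seminorm.comp_apply, Fintype.linearCombination_apply] at h2
    simp only [mul_smul, ← Finset.smul_sum, e.sum_repr', map_smul_eq_mul,
      Real.norm_of_nonneg hr.le] at h2
    exact (mul_le_iff_le_one_right hr).1 h2

theorem mem_unitCrossPolytope_iff (y : EuclideanSpace ℝ (Fin n)) :
    y ∈ unitCrossPolytope n ↔ ∑ k, |y k| ≤ 1 := by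
  constructor
  · intro h
    have := h (WithLp.toLp 2 fun k => if 0 ≤ y k then 1 else -1) (fun k => by
      show (if 0 ≤ y k then (1 : ℝ) else -1) ∈ _
      split_ifs <;> norm_num)
    rw [PiLp.inner_apply] at this
    refine le_of_eq_of_le (Finset.sum_congr rfl fun k _ => ?_) this
    show |y k| = y k * (if 0 ≤ y k then (1 : ℝ) else -1)
    split_ifs with hk
    · rw [abs_of_nonneg hk, mul_one]
    · rw [abs_of_neg (not_le.1 hk), mul_neg_one]
  · intro h x hx
    rw [PiLp.inner_apply]
    refine le_trans (Finset.sum_le_sum fun k _ => ?_) h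
    calc y k * x k ≤ |y k * x k| := le_abs_self _
      _ = |y k| * |x k| := abs_mul _ _
      _ ≤ |y k| * 1 := mul_le_mul_of_nonneg_left (abs_le.2 (hx k)) (abs_nonneg _)
      _ = |y k| := mul_one _

/-- A norm of dimension at most three whose distance ellipsoid of ratio `√n` is the Euclidean ball
has a parallelepiped or an octahedron as its unit ball. -/
theorem exists_linearEquiv_of_distance_position (hn : 0 < n) (hn3 : n ≤ 3)
    (hlow : ∀ x, ‖x‖ ≤ N x) (hup : ∀ x, N x ≤ √n * ‖x‖)
    (hmin : ¬ ∃ S : EuclideanSpace ℝ (Fin n) →L[ℝ] EuclideanSpace ℝ (Fin n),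
      ∀ x, ‖x‖ = 1 → ‖S x‖ < N x ∧ N x < √n * ‖S x‖) :
    ∃ L : EuclideanSpace ℝ (Fin n) ≃ₗ[ℝ] EuclideanSpace ℝ (Fin n),
      (∀ x, N x ≤ 1 ↔ L x ∈ unitCube n) ∨ ∀ x, N x ≤ 1 ↔ L x ∈ unitCrossPolytope n := by
  obtain ⟨ι, κ, _, _, w, μ, u, v, hu, hv, hsupp, hNv, huv⟩ := exists_contact_frames hn hlow hup hmin
  have hr : √(n : ℝ) ≠ 0 := (Real.sqrt_pos.2 (Nat.cast_pos.2 hn)).ne'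
  obtain ⟨e, he, hcase⟩ := hu.exists_orthonormal hn hn3 hv huv
  have hspan : ⊤ ≤ Submodule.span ℝ (Set.range e) := by
    rw [he.linearIndependent.span_eq_top_of_card_eq_finrank' (by simp)]
  set E := OrthonormalBasis.mk he hspan with hE
  have hEe : ∀ k, E k = e k := fun k => by rw [hE, OrthonormalBasis.coe_mk]
  simp only [← hEe] at hcase
  rcases hcase with h | h
  · refine ⟨E.repr.toLinearEquiv.trans (LinearEquiv.smulOfNeZero ℝ _ (√n) hr), Or.inl fun x => ?_⟩
    rw [Seminorm.le_one_iff_of_frames hn hn3 hu hv huv hsupp hNv E h]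
    refine forall_congr' fun k => ?_
    rw [abs_le]
    simp [E.repr_apply_apply]
  · refine ⟨E.repr.toLinearEquiv, Or.inr fun x => ?_⟩
    rw [Seminorm.eq_sum_abs_of_frames hn hn3 hu hv huv hsupp hNv E h, mem_unitCrossPolytope_iff]
    simp [E.repr_apply_apply]

end Norms

/-! ### Attainment of the distance and strict improvement -/

section Seminorms

variable {n : ℕ} {N : Seminorm ℝ (EuclideanSpace ℝ (Fin n))}

/-- The maps for `ε = 1/(k+1)` have operator norm at most `C`, so a subsequence converges. -/
theorem exists_position_of_forall_pos {C r : ℝ} (hC : 0 ≤ C) (hup : ∀ x, N x ≤ C * ‖x‖)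
    (h : ∀ ε > 0, ∃ S : EuclideanSpace ℝ (Fin n) →L[ℝ] EuclideanSpace ℝ (Fin n),
      ∀ x, ‖S x‖ ≤ N x ∧ N x ≤ (r + ε) * ‖S x‖) :
    ∃ S : EuclideanSpace ℝ (Fin n) →L[ℝ] EuclideanSpace ℝ (Fin n),
      ∀ x, ‖S x‖ ≤ N x ∧ N x ≤ r * ‖S x‖ := by
  choose S hS using fun k : ℕ => h (1 / ((k : ℝ) + 1)) Nat.one_div_pos_of_nat
  have hmem : ∀ k, S k ∈ Metric.closedBall
      (0 : EuclideanSpace ℝ (Fin n) →L[ℝ] EuclideanSpace ℝ (Fin n)) C := by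
    intro k
    rw [mem_closedBall_zero_iff]
    exact ContinuousLinearMap.opNorm_le_bound _ hC fun x => ((hS k x).1).trans (hup x)
  have : ProperSpace (EuclideanSpace ℝ (Fin n) →L[ℝ] EuclideanSpace ℝ (Fin n)) :=
    FiniteDimensional.proper ℝ _
  obtain ⟨S₀, -, φ, hφ, hlim⟩ := (isCompact_closedBall _ C).tendsto_subseq hmem
  refine ⟨S₀, fun x => ?_⟩
  have hx : Filter.Tendsto (fun k => ‖S (φ k) x‖) Filter.atTop (nhds ‖S₀ x‖) :=
    (((ContinuousLinearMap.apply ℝ _ x).continuous.tendsto S₀).comp hlim).norm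
  refine ⟨le_of_tendsto' hx fun k => (hS (φ k) x).1, ?_⟩
  have hε : Filter.Tendsto (fun k => r + 1 / (((φ k : ℕ) : ℝ) + 1)) Filter.atTop (nhds (r + 0)) :=
    tendsto_const_nhds.add ((tendsto_one_div_add_atTop_nhds_zero_nat (𝕜 := ℝ)).comp hφ.tendsto_atTop)
  rw [add_zero] at hε
  exact ge_of_tendsto' (hε.mul hx) fun k => (hS (φ k) x).2

/-- The ratio `N x / ‖S x‖` attains its maximum `b < r` on the sphere; homogeneity does the rest. -/
theorem exists_lt_of_forall_sphere_lt (hn : 0 < n) (hN : Continuous N) {r : ℝ}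
    {S : EuclideanSpace ℝ (Fin n) →L[ℝ] EuclideanSpace ℝ (Fin n)}
    (hS : ∀ x, ‖x‖ = 1 → ‖S x‖ < N x ∧ N x < r * ‖S x‖) :
    ∃ b, 0 < b ∧ b < r ∧ ∀ x, ‖S x‖ ≤ N x ∧ N x ≤ b * ‖S x‖ := by
  have hpos : ∀ x, ‖x‖ = 1 → 0 < ‖S x‖ := fun x hx => by
    refine (norm_nonneg _).lt_of_ne fun h => ?_
    have h2 := (hS x hx).2
    rw [← h, mul_zero] at h2
    exact absurd h2 (not_lt.2 (apply_nonneg N x))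
  have : Nonempty (Fin n) := ⟨⟨0, hn⟩⟩
  have hne : (Metric.sphere (0 : EuclideanSpace ℝ (Fin n)) 1).Nonempty :=
    NormedSpace.sphere_nonempty.2 zero_le_one
  obtain ⟨y, hy, hmax⟩ := (isCompact_sphere (0 : EuclideanSpace ℝ (Fin n)) 1).exists_isMaxOn hne
    (f := fun x => N x / ‖S x‖) (hN.continuousOn.div S.continuous.norm.continuousOn fun x hx =>
      (hpos x (mem_sphere_zero_iff_norm.1 hx)).ne')
  have hy := mem_sphere_zero_iff_norm.1 hy
  refine ⟨N y / ‖S y‖, div_pos ((norm_nonneg _).trans_lt (hS y hy).1) (hpos y hy),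
    (div_lt_iff₀ (hpos y hy)).2 (hS y hy).2, fun x => ?_⟩
  rcases eq_or_ne x 0 with rfl | hx
  · simp
  have hx0 : 0 < ‖x‖ := norm_pos_iff.2 hx
  have hz : ‖‖x‖⁻¹ • x‖ = 1 := by rw [norm_smul, norm_inv, norm_norm, inv_mul_cancel₀ hx0.ne']
  have h1 := (hS _ hz).1.le
  have h2 := hmax (mem_sphere_zero_iff_norm.2 hz)
  have h3 := (div_le_iff₀ (hpos _ hz)).1 h2
  simp only [map_smul, map_smul_eq_mul, norm_smul, norm_inv, norm_norm] at h1 h3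
  refine ⟨le_of_mul_le_mul_left h1 (inv_pos.2 hx0), ?_⟩
  rw [mul_left_comm] at h3
  exact le_of_mul_le_mul_left h3 (inv_pos.2 hx0)

theorem le_of_forall_le_one (hdef : ∀ x, N x = 0 → x = 0) {p : Seminorm ℝ (EuclideanSpace ℝ (Fin n))}
    {a : ℝ} (h : ∀ x, N x ≤ 1 → p x ≤ a) (x : EuclideanSpace ℝ (Fin n)) : p x ≤ a * N x := by
  rcases eq_or_ne x 0 with rfl | hx
  · simp
  have hpos : 0 < N x := (apply_nonneg N x).lt_of_ne fun h0 => hx (hdef x h0.symm)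
  have h1 := h ((N x)⁻¹ • x) (by
    rw [map_smul_eq_mul, norm_inv, Real.norm_of_nonneg hpos.le, inv_mul_cancel₀ hpos.ne'])
  rw [map_smul_eq_mul, norm_inv, Real.norm_of_nonneg hpos.le, inv_mul_le_iff₀ hpos] at h1
  linarith

/-- A linear map with trivial kernel, as an equivalence. -/
theorem exists_linearEquiv_eq {S : EuclideanSpace ℝ (Fin n) →L[ℝ] EuclideanSpace ℝ (Fin n)}
    (h : ∀ x, S x = 0 → x = 0) :
    ∃ T : EuclideanSpace ℝ (Fin n) ≃ₗ[ℝ] EuclideanSpace ℝ (Fin n), ∀ x, T x = S x :=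
  ⟨LinearEquiv.ofInjectiveEndo S.toLinearMap ((injective_iff_map_eq_zero S).2 h), fun _ => rfl⟩

end Seminorms

/-! ### From convex bodies to norms -/

section Bodies

variable {n : ℕ} {K : Set (EuclideanSpace ℝ (Fin n))} {c : EuclideanSpace ℝ (Fin n)}
  {N : Seminorm ℝ (EuclideanSpace ℝ (Fin n))}

/-- The norm whose unit ball is a given symmetric convex body, translated to the origin. -/
theorem exists_seminorm_of_symmetric (hconv : Convex ℝ K) (hcomp : IsCompact K)
    (hint : (interior K).Nonempty) (hc : ∀ x ∈ K, (2 : ℝ) • c - x ∈ K) :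
    ∃ N : Seminorm ℝ (EuclideanSpace ℝ (Fin n)), (∀ x, N x = 0 → x = 0) ∧
      (∃ C, 0 ≤ C ∧ ∀ x, N x ≤ C * ‖x‖) ∧ ∀ x, N x ≤ 1 ↔ c + x ∈ K := by
  set D : Set (EuclideanSpace ℝ (Fin n)) := (fun x => c + x) ⁻¹' K with hD
  have hDconv : Convex ℝ D := hconv.translate_preimage_right c
  have hneg : ∀ x ∈ D, -x ∈ D := by
    intro x hx
    have := hc _ hx
    show c + -x ∈ K
    convert this using 1
    module
  have hDint : interior D = (fun x => c + x) ⁻¹' interior K :=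
    ((Homeomorph.addLeft c).preimage_interior K).symm
  have hnhds : D ∈ nhds 0 := by
    rw [mem_interior_iff_mem_nhds.symm]
    obtain ⟨p, hp⟩ := hint
    have hq : p - c ∈ interior D := by
      rw [hDint]
      simpa using hp
    -- The origin is the midpoint of two opposite interior points.
    have hq' : -(p - c) ∈ interior D := by
      have hDneg : -D = D := Set.Subset.antisymm
        (fun x hx => by simpa using hneg _ hx) fun x hx => hneg x hx
      have h := (Homeomorph.neg (EuclideanSpace ℝ (Fin n))).preimage_interior D
      rw [show (Homeomorph.neg (EuclideanSpace ℝ (Fin n))) ⁻¹' D = D from hDneg] at h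
      rw [← h] at hq
      exact hq
    have := hDconv.interior hq hq' (a := 1 / 2) (b := 1 / 2) (by norm_num) (by norm_num)
      (by norm_num)
    rwa [smul_neg, add_neg_cancel] at this
  have hDcomp : IsCompact D := (Homeomorph.addLeft c).isCompact_preimage.2 hcomp
  have habs : Absorbent ℝ D := absorbent_nhds_zero hnhds
  have hbal : Balanced ℝ D := (balanced_iff_neg_mem hDconv).2 fun x hx => hneg x hx
  refine ⟨gaugeSeminorm hbal hDconv habs, fun x hx => ?_, ?_, fun x => ?_⟩
  · exact (gauge_eq_zero habs ((NormedSpace.isVonNBounded_iff ℝ).2 hDcomp.isBounded)).1 hx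
  · obtain ⟨r, hr, hball⟩ := Metric.mem_nhds_iff.1 hnhds
    refine ⟨r⁻¹, (inv_pos.2 hr).le, fun x => ?_⟩
    rw [le_inv_mul_iff₀ hr]
    exact mul_gauge_le_norm hball
  · rw [show gaugeSeminorm hbal hDconv habs x = gauge D x from rfl,
      gauge_le_one_iff_mem_closure hDconv hnhds, hDcomp.isClosed.closure_eq]
    rfl

/-- Applying the inclusions to a vector and its negative and subtracting cancels the translations
`u`, `v` and `c`. -/
theorem exists_position_of_subset (hdef : ∀ x, N x = 0 → x = 0) (hNK : ∀ x, N x ≤ 1 ↔ c + x ∈ K)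
    {ρ : ℝ} (hρ : 0 < ρ) {T : EuclideanSpace ℝ (Fin n) ≃ₗ[ℝ] EuclideanSpace ℝ (Fin n)}
    {u v : EuclideanSpace ℝ (Fin n)}
    (h1 : u +ᵥ K ⊆ T '' (v +ᵥ Metric.closedBall (0 : EuclideanSpace ℝ (Fin n)) 1))
    (h2 : T '' (v +ᵥ Metric.closedBall (0 : EuclideanSpace ℝ (Fin n)) 1) ⊆ ρ • (u +ᵥ K))
    (x : EuclideanSpace ℝ (Fin n)) : ‖T.symm x‖ ≤ N x ∧ N x ≤ ρ * ‖T.symm x‖ := by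
  have hmem : ∀ x, N x ≤ 1 → ∃ p, ‖p‖ ≤ 1 ∧ u + (c + x) = T (v + p) := by
    intro x hx
    obtain ⟨_, ⟨p, hp, rfl⟩, hpx⟩ := h1 ⟨c + x, (hNK x).1 hx, rfl⟩
    exact ⟨p, by simpa using hp, by simpa using hpx.symm⟩
  have hmem' : ∀ p, ‖p‖ ≤ 1 → ∃ x, N x ≤ 1 ∧ T (v + p) = ρ • (u + (c + x)) := by
    intro p hp
    obtain ⟨_, ⟨k, hk, rfl⟩, hkx⟩ := h2 ⟨v + p, ⟨p, by simpa using hp, rfl⟩, rfl⟩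
    refine ⟨k - c, (hNK _).2 (by simpa using hk), ?_⟩
    rw [add_sub_cancel]
    simpa using hkx.symm
  constructor
  · have := le_of_forall_le_one hdef (p := (normSeminorm ℝ _).comp T.symm.toLinearMap) (a := 1)
      (fun x hx => by
        obtain ⟨p, hp, hxp⟩ := hmem x hx
        obtain ⟨q, hq, hxq⟩ := hmem (-x) (by rwa [map_neg_eq_map])
        have hTx : x = T ((1 / 2 : ℝ) • (p - q)) := by
          have h3 : (u + (c + x)) - (u + (c + -x)) = T (p - q) := by
            rw [hxp, hxq, ← map_sub, add_sub_add_left_eq_sub]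
          rw [map_smul, ← h3]
          module
        rw [Seminorm.comp_apply]
        show ‖T.symm x‖ ≤ 1
        rw [hTx, T.symm_apply_apply, norm_smul]
        have := norm_sub_le p q
        norm_num
        linarith) x
    rw [one_mul] at this
    exact this
  · have := le_of_forall_le_one (N := normSeminorm ℝ _) (fun x hx => norm_eq_zero.1 hx)
      (p := N.comp T.toLinearMap) (a := ρ) (fun p hp => by
        have hp : ‖p‖ ≤ 1 := hp
        obtain ⟨x, hx, hxp⟩ := hmem' p hp
        obtain ⟨y, hy, hyp⟩ := hmem' (-p) (by rwa [norm_neg])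
        have hTp : T p = (ρ / 2) • (x - y) := by
          have h3 : T (v + p) - T (v + -p) = (2 : ℝ) • T p := by
            rw [← map_sub, ← map_smul]
            congr 1
            module
          rw [hxp, hyp] at h3
          rw [← inv_smul_smul₀ (two_ne_zero (α := ℝ)) (T p), ← h3]
          module
        rw [Seminorm.comp_apply]
        show N (T p) ≤ ρ
        rw [hTp, map_smul_eq_mul, Real.norm_of_nonneg (by positivity)]
        have := map_sub_le_add N x y
        nlinarith) (T.symm x)
    rw [Seminorm.comp_apply] at this
    simpa using this

theorem banachMazurDist_le_of_position (hNK : ∀ x, N x ≤ 1 ↔ c + x ∈ K) {ρ : ℝ} (hρ : 0 < ρ)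
    (S : EuclideanSpace ℝ (Fin n) ≃ₗ[ℝ] EuclideanSpace ℝ (Fin n))
    (hS : ∀ x, ‖S x‖ ≤ N x ∧ N x ≤ ρ * ‖S x‖) :
    banachMazurDist K (Metric.closedBall (0 : EuclideanSpace ℝ (Fin n)) 1) ≤ ρ := by
  refine csInf_le ⟨0, fun _ h => h.1.le⟩ ⟨hρ, S.symm, -c, 0, ?_, ?_⟩
  · rintro _ ⟨k, hk, rfl⟩
    rw [zero_vadd]
    refine ⟨S (-c + k), ?_, S.symm_apply_apply _⟩
    rw [mem_closedBall_zero_iff]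
    exact (hS _).1.trans ((hNK _).2 (by simpa using hk))
  · rintro _ ⟨p, hp, rfl⟩
    rw [zero_vadd, mem_closedBall_zero_iff] at hp
    refine ⟨ρ⁻¹ • S.symm p, ⟨c + ρ⁻¹ • S.symm p, (hNK _).1 ?_, ?_⟩, smul_inv_smul₀ hρ.ne' _⟩
    · rw [map_smul_eq_mul, norm_inv, Real.norm_of_nonneg hρ.le, inv_mul_le_iff₀ hρ]
      refine (hS _).2.trans (mul_le_mul_of_nonneg_left ?_ hρ.le)
      rwa [S.apply_symm_apply]
    · simp

theorem exists_position_of_banachMazurDist_lt (hdef : ∀ x, N x = 0 → x = 0)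
    (hNK : ∀ x, N x ≤ 1 ↔ c + x ∈ K) {r : ℝ}
    (hpos : 0 < banachMazurDist K (Metric.closedBall (0 : EuclideanSpace ℝ (Fin n)) 1))
    (hlt : banachMazurDist K (Metric.closedBall (0 : EuclideanSpace ℝ (Fin n)) 1) < r) :
    ∃ S : EuclideanSpace ℝ (Fin n) →L[ℝ] EuclideanSpace ℝ (Fin n),
      ∀ x, ‖S x‖ ≤ N x ∧ N x ≤ r * ‖S x‖ := by
  rw [banachMazurDist] at hpos hlt
  -- Since `sInf ∅ = 0`, positivity of the distance ensures that some admissible `ρ` exists.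
  have hne : ∀ {s : Set ℝ}, 0 < sInf s → s.Nonempty := fun {s} hs => by
    rw [Set.nonempty_iff_ne_empty]
    rintro rfl
    exact hs.ne' Real.sInf_empty
  obtain ⟨ρ, ⟨hρ, T, u, v, h1, h2⟩, hρr⟩ := exists_lt_of_csInf_lt (hne hpos) hlt
  refine ⟨LinearMap.toContinuousLinearMap T.symm.toLinearMap, fun x => ?_⟩
  obtain ⟨h3, h4⟩ := exists_position_of_subset hdef hNK hρ h1 h2 x
  exact ⟨h3, h4.trans (mul_le_mul_of_nonneg_right hρr.le (norm_nonneg _))⟩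

theorem exists_linearEquiv_of_banachMazurDist_eq (hn : 0 < n) (hn3 : n ≤ 3)
    (hdef : ∀ x, N x = 0 → x = 0) {C : ℝ} (hC : 0 ≤ C) (hup : ∀ x, N x ≤ C * ‖x‖)
    (hNK : ∀ x, N x ≤ 1 ↔ c + x ∈ K)
    (hdist : banachMazurDist K (Metric.closedBall (0 : EuclideanSpace ℝ (Fin n)) 1) = √n) :
    ∃ L : EuclideanSpace ℝ (Fin n) ≃ₗ[ℝ] EuclideanSpace ℝ (Fin n),
      (∀ x, N x ≤ 1 ↔ L x ∈ unitCube n) ∨ ∀ x, N x ≤ 1 ↔ L x ∈ unitCrossPolytope n := by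
  have hr : 0 < √(n : ℝ) := Real.sqrt_pos.2 (Nat.cast_pos.2 hn)
  have hinj : ∀ {S : EuclideanSpace ℝ (Fin n) →L[ℝ] EuclideanSpace ℝ (Fin n)} {b : ℝ},
      (∀ x, N x ≤ b * ‖S x‖) → ∀ x, S x = 0 → x = 0 := by
    intro S b h x hx
    refine hdef x (le_antisymm ?_ (apply_nonneg N x))
    simpa [hx] using h x
  obtain ⟨S₀, hS₀⟩ := exists_position_of_forall_pos (N := N) (r := √n) hC hup fun ε hε =>
    exists_position_of_banachMazurDist_lt hdef hNK (hdist ▸ hr) (by linarith)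
  obtain ⟨S, hS⟩ := exists_linearEquiv_eq (hinj fun x => (hS₀ x).2)
  simp only [← hS] at hS₀
  have hN' : ∀ x, (N.comp S.symm.toLinearMap) x = N (S.symm x) := fun x => rfl
  have hup' : ∀ x, (N.comp S.symm.toLinearMap) x ≤ √n * ‖x‖ := fun x => by
    simpa using (hS₀ (S.symm x)).2
  obtain ⟨L, hL⟩ := exists_linearEquiv_of_distance_position (N := N.comp S.symm.toLinearMap) hn hn3
    (fun x => by simpa using (hS₀ (S.symm x)).1) hup' (by
      -- A strict improvement `R` would make `R ∘ S` realize a ratio `b < √n` for `K`.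
      rintro ⟨R, hR⟩
      obtain ⟨b, hb, hbr, hRb⟩ := exists_lt_of_forall_sphere_lt hn
        (continuous_of_le_mul_norm hup') hR
      have hRS : ∀ x, ‖R (S x)‖ ≤ N x ∧ N x ≤ b * ‖R (S x)‖ := fun x => by
        simpa [hN'] using hRb (S x)
      obtain ⟨Q, hQ⟩ := exists_linearEquiv_eq
        (S := R.comp (LinearMap.toContinuousLinearMap S.toLinearMap))
        (hinj (b := b) fun x => (hRS x).2)
      have := banachMazurDist_le_of_position hNK hb Q fun x => by
        rw [hQ]
        exact hRS x
      rw [hdist] at this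
      linarith)
  refine ⟨S.trans L, hL.imp (fun h x => ?_) fun h x => ?_⟩
  · simpa [hN'] using h (S x)
  · simpa [hN'] using h (S x)

end Bodies

theorem theorem2p4 (n : ℕ) (hn : n ≤ 3) (K : ConvexBody (EuclideanSpace ℝ (Fin n)))
    (hint : (interior (K : Set (EuclideanSpace ℝ (Fin n)))).Nonempty)
    (hsymm : IsCentrallySymmetric (K : Set (EuclideanSpace ℝ (Fin n))))
    (hdist : banachMazurDist (K : Set (EuclideanSpace ℝ (Fin n)))
      (Metric.closedBall (0 : EuclideanSpace ℝ (Fin n)) 1) = Real.sqrt n) :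
    ∃ A : EuclideanSpace ℝ (Fin n) ≃ᵃ[ℝ] EuclideanSpace ℝ (Fin n),
      (K : Set (EuclideanSpace ℝ (Fin n))) = A '' unitCube n ∨
        (K : Set (EuclideanSpace ℝ (Fin n))) = A '' unitCrossPolytope n := by
  rcases Nat.eq_zero_or_pos n with rfl | hn0
  -- In dimension 0 the space is a point, and `K` and the cube are all of it.
  · refine ⟨AffineEquiv.refl ℝ _, Or.inl ?_⟩
    have hcube : unitCube 0 = Set.univ := Set.eq_univ_of_forall fun x i => i.elim0
    rw [hcube, Subsingleton.eq_univ_of_nonempty K.nonempty]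
    simp
  obtain ⟨c, hc⟩ := hsymm
  obtain ⟨N, hdef, ⟨C, hC, hup⟩, hNK⟩ :=
    exists_seminorm_of_symmetric K.convex K.isCompact hint hc
  obtain ⟨L, hL⟩ := exists_linearEquiv_of_banachMazurDist_eq hn0 hn hdef hC hup hNK hdist
  have himage : ∀ X : Set (EuclideanSpace ℝ (Fin n)), (∀ x, N x ≤ 1 ↔ L x ∈ X) →
      (K : Set (EuclideanSpace ℝ (Fin n))) =
        (L.symm.toAffineEquiv.trans (AffineEquiv.constVAdd ℝ _ c)) '' X := by
    intro X hX
    ext x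
    constructor
    · intro hx
      refine ⟨L (x - c), (hX _).1 ((hNK _).2 (by simpa using hx)), ?_⟩
      simp
    · rintro ⟨y, hy, rfl⟩
      have := (hNK (L.symm y)).1 ((hX _).2 (by simpa using hy))
      simpa using this
  exact ⟨_, hL.imp (himage _) (himage _)⟩
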